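/- Let $\mathbb{K}\in\{\mathbb{R},\mathbb{C}\}$ and let $\Gamma=(V,E,a,b,\gamma_0,\gamma_1)$ be a metric graph: $V$ (vertices) and $E$ (edges) are arbitrary sets, not necessarily finite or countable; $a,b\colon E\to[-\infty,\infty]$ satisfy $a_e<b_e$ for all $e\in E$, the edge $e$ corresponding to the interval $(a_e,b_e)\subseteq\mathbb{R}$; with $E_{\mathrm{li}}:=\{e\in E : a_e>-\infty\}$ and $E_{\mathrm{re}}:=\{e\in E : b_e<\infty\}$, the maps $\gamma_0\colon E_{\mathrm{li}}\to V$ and $\gamma_1\colon E_{\mathrm{re}}\to V$ give the starting vertex and the end vertex. Assume that the edge lengths are bounded below, $$\inf_{e\in E}(b_e-a_e)>0 .$$ Let $\mathcal{H}_\Gamma:=\bigoplus_{e\in E}L_2(a_e,b_e)$ (Hilbert space direct sum over $\mathbb{K}$), and let $\hat H$ be the maximal first-derivative operator in $\mathcal{H}_\Gamma$, $$D(\hat H):=\bigoplus_{e\in E}W_2^1(a_e,b_e)=\{f\in\mathcal{H}_\Gamma : \text{the weak derivatives } f_e' \text{ exist and } (f_e')_{e\in E}\in\mathcal{H}_\Gamma\},\qquad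 \hat Hf:=(f_e')_{e\in E}.$$ Define the linear maps $\operatorname{tr}_{\mathrm{li}}\colon D(\hat H)\to\ell_2(E_{\mathrm{li}})$ and $\operatorname{tr}_{\mathrm{re}}\colon D(\hat H)\to\ell_2(E_{\mathrm{re}})$ by $(\operatorname{tr}_{\mathrm{li}}f)(e):=f_e(a_e)$ and $(\operatorname{tr}_{\mathrm{re}}f)(e):=f_e(b_e)$, the end point values of the continuous representative of $f_e$. A linear operator $H$ in $\mathcal{H}_\Gamma$, with domain a linear subspace, is called skew-self-adjoint if its graph $G(H)$ satisfies $$G(H)=\{(y,-x) : (y,x)\in G(H)^*\},\qquad G(H)^*:=\{(y,x)\in\mathcal{H}_\Gamma\oplus\mathcal{H}_\Gamma : \langle y,v\rangle=\langle x,u\rangle \text{ for all } (u,v)\in G(H)\}.$$ Then a linear operator $H\subseteq\hat H$ (a restriction of $\hat H$ to a linear subspace of $D(\hat H)$) is skew-self-adjoint if and only if there exists a unitary operator $L$ from $\ell_2(E_{\mathrm{re}})$ to $\ell_2(E_{\mathrm{li}})$ such that $$D(H)=\{f\in D(\hat H) : L\operatorname{tr}_{\mathrm{re}}f=\operatorname{tr}_{\mathrm{li}}f\}.$$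 -/

import Mathlib

namespace IntervalSobolev

open MeasureTheory Set Filter Topology
open scoped ENNReal ContDiff

variable {𝕜 : Type*} [RCLike 𝕜]

/-- `g` is a weak derivative of `f` on the open set `I ⊆ ℝ`. -/
def HasWeakDeriv (I : Set ℝ) (f g : ℝ → 𝕜) : Prop :=
  ∀ φ : ℝ → ℝ, ContDiff ℝ ∞ φ → HasCompactSupport φ → tsupport φ ⊆ I →
    ∫ x in I, deriv φ x • f x = -∫ x in I, φ x • g x

lemma integrableOn_smul {I : Set ℝ} {f : ℝ → 𝕜}
    (hf : MemLp f 2 (volume.restrict I)) {φ : ℝ → ℝ} (hφ : Continuous φ)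
    (hc : HasCompactSupport φ) : Integrable (fun x => φ x • f x) (volume.restrict I) :=
  (hf.locallyIntegrable (by norm_num)).integrable_smul_left_of_hasCompactSupport hφ hc

lemma exists_Icc {K : Set ℝ} (hK : IsCompact K) : ∃ s t : ℝ, s < t ∧ K ⊆ Ioo s t := by
  obtain ⟨r, hr⟩ := hK.isBounded.subset_ball (0 : ℝ)
  rw [Real.ball_eq_Ioo] at hr
  exact ⟨0 - max r 1, 0 + max r 1, by have := le_max_right r 1; linarith,
    hr.trans (Ioo_subset_Ioo (by have := le_max_left r 1; linarith)
      (by have := le_max_left r 1; linarith))⟩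

/-- Integration by parts for the primitive of a locally integrable function. -/
lemma integral_deriv_smul_primitive {G : ℝ → 𝕜} (hG : LocallyIntegrable G volume) (x₀ : ℝ)
    {φ : ℝ → ℝ} (hφ : ContDiff ℝ ∞ φ) (hc : HasCompactSupport φ) :
    ∫ x, deriv φ x • (∫ y in x₀..x, G y) = -∫ x, φ x • G x := by
  obtain ⟨s, t, hst, hK⟩ := exists_Icc hc
  have hφ1 : ContDiff ℝ 1 φ := hφ.of_le (by exact_mod_cast le_top)
  have hd : Differentiable ℝ φ := hφ1.differentiable (by norm_num)
  have hdc : Continuous (deriv φ) := hφ1.continuous_deriv (by norm_num)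
  have hdcs : HasCompactSupport (deriv φ) := hc.deriv
  have hi : ∀ a b, IntervalIntegrable G volume a b := fun a b =>
    (hG.integrableOn_isCompact isCompact_uIcc).intervalIntegrable
  have hcont : ∀ c, Continuous fun x => ∫ y in c..x, G y :=
    fun c => intervalIntegral.continuous_primitive hi c
  have hφ0 : ∀ x, x ∉ Ioo s t → φ x = 0 := fun x hx =>
    image_eq_zero_of_notMem_tsupport fun h => hx (hK h)
  have hφ0' : ∀ x, x ∉ Ioo s t → deriv φ x = 0 := fun x hx =>
    image_eq_zero_of_notMem_tsupport fun h => hx (hK (tsupport_deriv_subset h))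
  have hφint : ∫ x, deriv φ x = 0 :=
    integral_eq_zero_of_hasDerivAt_of_integrable (fun x => (hd x).hasDerivAt)
      (hdc.integrable_of_hasCompactSupport hdcs) (hφ.continuous.integrable_of_hasCompactSupport hc)
  have hshift : ∫ x, deriv φ x • (∫ y in x₀..x, G y) = ∫ x, deriv φ x • (∫ y in s..x, G y) := by
    have h1 : ∀ x, deriv φ x • (∫ y in x₀..x, G y)
        = deriv φ x • (∫ y in x₀..s, G y) + deriv φ x • (∫ y in s..x, G y) := fun x => by
      rw [← smul_add, intervalIntegral.integral_add_adjacent_intervals (hi _ _) (hi _ _)]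
    simp_rw [h1]
    rw [integral_add, integral_smul_const, hφint, zero_smul, zero_add]
    · exact (hdc.smul continuous_const).integrable_of_hasCompactSupport hdcs.smul_right
    · exact (hdc.smul (hcont s)).integrable_of_hasCompactSupport hdcs.smul_right
  rw [hshift]
  have hGi : IntegrableOn G (Ioc s t) := (hi s t).1
  have hφi : IntegrableOn (deriv φ) (Ioc s t) :=
    (hdc.integrable_of_hasCompactSupport hdcs).integrableOn
  have hset : MeasurableSet {p : ℝ × ℝ | p.2 ≤ p.1} := measurableSet_le measurable_snd measurable_fst
  have hint : Integrable (Function.uncurry fun x y : ℝ =>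
      {p : ℝ × ℝ | p.2 ≤ p.1}.indicator (fun p => deriv φ p.1 • G p.2) (x, y))
      ((volume.restrict (Ioc s t)).prod (volume.restrict (Ioc s t))) :=
    (hφi.smul_prod hGi).indicator hset
  calc ∫ x, deriv φ x • (∫ y in s..x, G y)
      = ∫ x in Ioc s t, deriv φ x • (∫ y in s..x, G y) := by
        refine (setIntegral_eq_integral_of_forall_compl_eq_zero fun x hx => ?_).symm
        rw [hφ0' x fun h => hx (Ioo_subset_Ioc_self h), zero_smul]
    _ = ∫ x in Ioc s t, ∫ y in Ioc s t,
          {p : ℝ × ℝ | p.2 ≤ p.1}.indicator (fun p => deriv φ p.1 • G p.2) (x, y) := by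
        refine setIntegral_congr_fun measurableSet_Ioc fun x hx => ?_
        have : (fun y => {p : ℝ × ℝ | p.2 ≤ p.1}.indicator (fun p => deriv φ p.1 • G p.2) (x, y))
            = (Iic x).indicator fun y => deriv φ x • G y := by
          ext y; simp [indicator]
        simp only [this]
        rw [setIntegral_indicator measurableSet_Iic, integral_smul,
          intervalIntegral.integral_of_le hx.1.le]
        congr 2
        rw [Ioc_inter_Iic, min_eq_right hx.2]
    _ = ∫ y in Ioc s t, ∫ x in Ioc s t,
          {p : ℝ × ℝ | p.2 ≤ p.1}.indicator (fun p => deriv φ p.1 • G p.2) (x, y) :=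
        integral_integral_swap hint
    _ = ∫ y in Ioc s t, -(φ y • G y) := by
        refine setIntegral_congr_fun measurableSet_Ioc fun y hy => ?_
        have : (fun x => {p : ℝ × ℝ | p.2 ≤ p.1}.indicator (fun p => deriv φ p.1 • G p.2) (x, y))
            = (Ici y).indicator fun x => deriv φ x • G y := by
          ext x; simp [indicator]
        simp only [this]
        rw [setIntegral_indicator measurableSet_Ici, integral_smul_const, ← neg_smul]
        congr 1
        have h2 : Ioc s t ∩ Ici y = Icc y t := by
          ext x; simp only [mem_inter_iff, mem_Ioc, mem_Ici, mem_Icc]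
          constructor
          · rintro ⟨⟨_, h⟩, h'⟩; exact ⟨h', h⟩
          · rintro ⟨h, h'⟩; exact ⟨⟨hy.1.trans_le h, h'⟩, h⟩
        rw [h2, integral_Icc_eq_integral_Ioc, ← intervalIntegral.integral_of_le hy.2,
          intervalIntegral.integral_deriv_eq_sub (fun x _ => hd x)
            (hdc.intervalIntegrable _ _), hφ0 t (by simp), zero_sub]
    _ = -∫ x, φ x • G x := by
        rw [integral_neg, setIntegral_eq_integral_of_forall_compl_eq_zero fun x hx => ?_]
        rw [hφ0 x fun h => hx (Ioo_subset_Ioc_self h), zero_smul]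

/-- A function whose weak derivative vanishes on an open interval is a.e. constant there. -/
lemma exists_ae_eq_const {I : Set ℝ} (hI : IsOpen I) (hI' : I.OrdConnected) {h : ℝ → 𝕜}
    (hh : LocallyIntegrable h (volume.restrict I))
    (h0 : ∀ φ : ℝ → ℝ, ContDiff ℝ ∞ φ → HasCompactSupport φ → tsupport φ ⊆ I →
      ∫ x in I, deriv φ x • h x = 0) :
    ∃ c : 𝕜, h =ᵐ[volume.restrict I] fun _ => c := by
  rcases I.eq_empty_or_nonempty with rfl | ⟨x₀, hx₀⟩
  · exact ⟨0, by simp [Filter.EventuallyEq]⟩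
  obtain ⟨r, hr, hrI⟩ := Metric.isOpen_iff.1 hI x₀ hx₀
  let B : ContDiffBump x₀ := ⟨r / 4, r / 2, by positivity, by linarith⟩
  let η : ℝ → ℝ := B.normed volume
  have hη : ContDiff ℝ ∞ η := B.contDiff_normed
  have hηc : HasCompactSupport η := B.hasCompactSupport_normed
  have hηI : tsupport η ⊆ I := by
    rw [B.tsupport_normed_eq]
    exact (Metric.closedBall_subset_ball (show r / 2 < r by linarith)).trans hrI
  have hη1 : ∫ x, η x = 1 := B.integral_normed
  refine ⟨∫ x in I, η x • h x, ?_⟩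
  set c := ∫ x in I, η x • h x with hc
  have hsm : ∀ {φ : ℝ → ℝ}, Continuous φ → HasCompactSupport φ →
      Integrable (fun x => φ x • h x) (volume.restrict I) :=
    fun hφ hφc => hh.integrable_smul_left_of_hasCompactSupport hφ hφc
  have key : ∀ φ : ℝ → ℝ, ContDiff ℝ ∞ φ → HasCompactSupport φ → tsupport φ ⊆ I →
      ∫ x, φ x • (h x - c) = 0 := by
    intro φ hφ hφc hφI
    let ψ : ℝ → ℝ := fun x => φ x - (∫ y, φ y) * η x
    have hψ : ContDiff ℝ ∞ ψ := hφ.sub (contDiff_const.mul hη)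
    have hφi : Integrable φ := hφ.continuous.integrable_of_hasCompactSupport hφc
    have hηi : Integrable η := hη.continuous.integrable_of_hasCompactSupport hηc
    have hψ0 : ∫ x, ψ x = 0 := by
      simp only [ψ]
      rw [integral_sub hφi (hηi.const_mul _), integral_const_mul, hη1, mul_one, sub_self]
    let K := tsupport φ ∪ tsupport η
    have hK : IsCompact K := hφc.union hηc
    have hKI : K ⊆ I := union_subset hφI hηI
    have hKne : K.Nonempty := ⟨x₀, Or.inr (by
      rw [B.tsupport_normed_eq]; exact Metric.mem_closedBall_self (by positivity))⟩
    have hψK : ∀ x, x ∉ K → ψ x = 0 := by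
      intro x hx
      simp only [K, mem_union, not_or] at hx
      simp only [ψ, image_eq_zero_of_notMem_tsupport hx.1, image_eq_zero_of_notMem_tsupport hx.2]
      simp
    let s := sInf K
    let t := sSup K
    have hs : s ∈ K := hK.sInf_mem hKne
    have ht : t ∈ K := hK.sSup_mem hKne
    have hKst : K ⊆ Icc s t := fun x hx =>
      ⟨csInf_le hK.bddBelow hx, le_csSup hK.bddAbove hx⟩
    have hstI : Icc s t ⊆ I := hI'.out (hKI hs) (hKI ht)
    have hst : s ≤ t := (hKst hs).2
    let Φ : ℝ → ℝ := fun x => ∫ y in s..x, ψ y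
    have hΦd : ∀ x, HasDerivAt Φ (ψ x) x := fun x =>
      intervalIntegral.integral_hasDerivAt_right (hψ.continuous.intervalIntegrable _ _)
        (hψ.continuous.stronglyMeasurableAtFilter _ _) hψ.continuous.continuousAt
    have hΦ' : deriv Φ = ψ := funext fun x => (hΦd x).deriv
    have hΦ : ContDiff ℝ ∞ Φ :=
      contDiff_infty_iff_deriv.2 ⟨fun x => (hΦd x).differentiableAt, hΦ'.symm ▸ hψ⟩
    have hΦ0 : ∀ x, x ∉ Icc s t → Φ x = 0 := by
      intro x hx
      rcases lt_or_ge x s with hxs | hxs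
      · simp only [Φ]
        rw [intervalIntegral.integral_symm, intervalIntegral.integral_of_le hxs.le,
          ← integral_Ico_eq_integral_Ioc,
          setIntegral_congr_fun (g := fun _ => (0 : ℝ)) measurableSet_Ico]
        · simp
        · intro y hy
          exact hψK y fun hyK => absurd (hKst hyK).1 (not_le.2 hy.2)
      · have hxt : t < x := lt_of_not_ge fun h => hx ⟨hxs, h⟩
        simp only [Φ]
        rw [intervalIntegral.integral_of_le hxs, ← integral_Icc_eq_integral_Ioc,
          setIntegral_eq_integral_of_forall_compl_eq_zero, hψ0]
        intro y hy
        exact hψK y fun hyK => hy ⟨(hKst hyK).1, (hKst hyK).2.trans hxt.le⟩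
    have hΦs : tsupport Φ ⊆ Icc s t :=
      closure_minimal (fun x hx => by by_contra h; exact hx (hΦ0 x h)) isClosed_Icc
    have hΦc : HasCompactSupport Φ := isCompact_Icc.of_isClosed_subset (isClosed_tsupport _) hΦs
    have := h0 Φ hΦ hΦc (hΦs.trans hstI)
    rw [hΦ'] at this
    have h3 : ∫ x in I, φ x • h x = (∫ y, φ y) • c := by
      have e : ∀ x, ψ x • h x = φ x • h x - (∫ y, φ y) • (η x • h x) := fun x => by
        simp only [ψ, sub_smul, mul_smul]
      simp_rw [e] at this
      rw [integral_sub (hsm hφ.continuous hφc) (by exact (hsm hη.continuous hηc).smul (∫ y, φ y)), integral_smul,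
        sub_eq_zero] at this
      exact this
    have hφ0 : ∀ x, x ∉ I → φ x = 0 := fun x hx =>
      image_eq_zero_of_notMem_tsupport fun h => hx (hφI h)
    rw [← setIntegral_eq_integral_of_forall_compl_eq_zero (s := I)
      (fun x hx => by rw [hφ0 x hx, zero_smul])]
    simp_rw [smul_sub]
    rw [integral_sub (hsm hφ.continuous hφc) (hφi.integrableOn.smul_const c), h3,
      integral_smul_const, setIntegral_eq_integral_of_forall_compl_eq_zero hφ0, sub_self]
  have hloc : LocallyIntegrableOn (fun x => h x - c) I volume := by
    refine LocallyIntegrableOn.sub ?_ ((locallyIntegrable_const c).locallyIntegrableOn I)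
    rw [locallyIntegrableOn_iff hI.isLocallyClosed]
    intro k hk hkc
    have := hh.integrableOn_isCompact hkc
    rwa [IntegrableOn, Measure.restrict_restrict hkc.measurableSet,
      inter_eq_left.2 hk] at this
  have := hI.ae_eq_zero_of_integral_contDiff_smul_eq_zero hloc key
  rw [Filter.EventuallyEq, ae_restrict_iff' hI.measurableSet]
  filter_upwards [this] with x hx hxI
  exact sub_eq_zero.1 (hx hxI)

lemma HasWeakDeriv.ae_unique {I : Set ℝ} (hI : IsOpen I) {f g₁ g₂ : ℝ → 𝕜}
    (hg₁ : MemLp g₁ 2 (volume.restrict I)) (hg₂ : MemLp g₂ 2 (volume.restrict I))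
    (h₁ : HasWeakDeriv I f g₁) (h₂ : HasWeakDeriv I f g₂) : g₁ =ᵐ[volume.restrict I] g₂ := by
  have hloc : LocallyIntegrableOn (fun x => g₁ x - g₂ x) I volume := by
    rw [locallyIntegrableOn_iff hI.isLocallyClosed]
    intro k hk hkc
    have := ((hg₁.sub hg₂).locallyIntegrable (by norm_num)).integrableOn_isCompact hkc
    rwa [IntegrableOn, Measure.restrict_restrict hkc.measurableSet, inter_eq_left.2 hk] at this
  have := hI.ae_eq_zero_of_integral_contDiff_smul_eq_zero hloc fun φ hφ hφc hφI => by
    rw [← setIntegral_eq_integral_of_forall_compl_eq_zero (s := I) (fun x hx => by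
      rw [image_eq_zero_of_notMem_tsupport fun h => hx (hφI h), zero_smul])]
    simp_rw [smul_sub]
    rw [integral_sub (integrableOn_smul hg₁ hφ.continuous hφc)
      (integrableOn_smul hg₂ hφ.continuous hφc), sub_eq_zero, ← neg_inj,
      ← h₁ φ hφ hφc hφI, ← h₂ φ hφ hφc hφI]
  rw [Filter.EventuallyEq, ae_restrict_iff' hI.measurableSet]
  filter_upwards [this] with x hx hxI
  exact sub_eq_zero.1 (hx hxI)

/-- A function in `L²(I)` with weak derivative `g ∈ L²(I)` is a.e. a primitive of `g`. -/
lemma HasWeakDeriv.exists_primitive {I : Set ℝ} (hI : IsOpen I) (hI' : I.OrdConnected)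
    {f g : ℝ → 𝕜} (hf : MemLp f 2 (volume.restrict I)) (hg : MemLp g 2 (volume.restrict I))
    (h : HasWeakDeriv I f g) :
    ∃ F : ℝ → 𝕜, Continuous F ∧ F =ᵐ[volume.restrict I] f ∧
      ∀ x y, F y - F x = ∫ t in x..y, I.indicator g t := by
  have hG : LocallyIntegrable (I.indicator g) volume :=
    ((memLp_indicator_iff_restrict hI.measurableSet).2 hg).locallyIntegrable (by norm_num)
  have hi : ∀ a b, IntervalIntegrable (I.indicator g) volume a b :=
    fun a b =>
    (hG.integrableOn_isCompact isCompact_uIcc).intervalIntegrable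
  let P : ℝ → 𝕜 := fun x => ∫ t in (0 : ℝ)..x, I.indicator g t
  have hP : Continuous P := intervalIntegral.continuous_primitive hi 0
  have hPl : LocallyIntegrable P (volume.restrict I) :=
    hP.locallyIntegrable
  have hfl : LocallyIntegrable f (volume.restrict I) := hf.locallyIntegrable (by norm_num)
  obtain ⟨c, hc⟩ := exists_ae_eq_const hI hI' (hfl.sub hPl) fun φ hφ hφc hφI => by
    have hφ1 : ContDiff ℝ 1 φ := hφ.of_le (by exact_mod_cast le_top)
    have hdc : Continuous (deriv φ) := hφ1.continuous_deriv (by norm_num)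
    simp_rw [Pi.sub_apply, smul_sub]
    rw [integral_sub (hfl.integrable_smul_left_of_hasCompactSupport hdc hφc.deriv)
      (hPl.integrable_smul_left_of_hasCompactSupport hdc hφc.deriv), h φ hφ hφc hφI,
      setIntegral_eq_integral_of_forall_compl_eq_zero (s := I) (f := fun x => deriv φ x • P x)
        (fun x hx => by
          rw [image_eq_zero_of_notMem_tsupport
            fun h => hx (hφI (tsupport_deriv_subset h)), zero_smul]),
      integral_deriv_smul_primitive hG 0 hφ hφc, sub_eq_zero, neg_inj,
      ← integral_indicator hI.measurableSet]
    congr 1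
    ext x
    by_cases hx : x ∈ I <;> simp [hx]
  refine ⟨fun x => c + P x, continuous_const.add hP, ?_, fun x y => ?_⟩
  · filter_upwards [hc] with x hx
    rw [← hx]; simp
  · simp only [P]
    rw [add_sub_add_left_eq_sub, intervalIntegral.integral_interval_sub_left (hi _ _) (hi _ _)]


lemma sq_integral_le {s t : ℝ} (hst : s < t) {u : ℝ → ℝ}
    (hu : MemLp u 2 (volume.restrict (Ioc s t))) :
    (∫ x in Ioc s t, u x) ^ 2 ≤ (t - s) * ∫ x in Ioc s t, u x ^ 2 := by
  have hts : 0 < t - s := sub_pos.2 hst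
  have hv : volume.real (Ioc s t) = t - s := by
    rw [Measure.real, Real.volume_Ioc, ENNReal.toReal_ofReal hts.le]
  have hu1 : Integrable u (volume.restrict (Ioc s t)) := hu.integrable (by norm_num)
  have hu2 : Integrable (fun x => u x ^ 2) (volume.restrict (Ioc s t)) := hu.integrable_sq
  set A := ∫ x in Ioc s t, u x
  have h0 : 0 ≤ ∫ x in Ioc s t, (((t - s) ^ 2 * u x ^ 2 - (2 * A * (t - s)) * u x) + A ^ 2) :=
    integral_nonneg fun x => by
      have : ((t - s) ^ 2 * u x ^ 2 - (2 * A * (t - s)) * u x) + A ^ 2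
        = ((t - s) * u x - A) ^ 2 := by ring
      simp only [this]; positivity
  rw [integral_add (by exact (hu2.const_mul _).sub (hu1.const_mul _)) (integrable_const _),
    integral_sub (hu2.const_mul _) (hu1.const_mul _), integral_const_mul, integral_const_mul,
    setIntegral_const, hv, smul_eq_mul] at h0
  change 0 ≤ (t - s) ^ 2 * _ - 2 * A * (t - s) * A + (t - s) * A ^ 2 at h0
  have : 0 ≤ (t - s) * ((t - s) * (∫ x in Ioc s t, u x ^ 2) - A ^ 2) := by linarith
  have := nonneg_of_mul_nonneg_right this hts
  linarith

/-- The one-dimensional Sobolev inequality for point values. -/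
lemma sq_norm_apply_le {I : Set ℝ} (hI : MeasurableSet I) {F g : ℝ → 𝕜}
    (hF : MemLp F 2 (volume.restrict I)) (hg : MemLp g 2 (volume.restrict I))
    (hFg : ∀ x y, F y - F x = ∫ t in x..y, I.indicator g t)
    {s t p : ℝ} (hst : s < t) (hsub : Ioo s t ⊆ I) (hp : p ∈ Icc s t) :
    (t - s) * ‖F p‖ ^ 2 ≤
      2 * (∫ x in I, ‖F x‖ ^ 2) + 2 * (t - s) ^ 2 * ∫ x in I, ‖g x‖ ^ 2 := by
  have hts : 0 < t - s := sub_pos.2 hst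
  have hv : volume.real (Ioo s t) = t - s := by
    rw [Measure.real, Real.volume_Ioo, ENNReal.toReal_ofReal hts.le]
  have hG : MemLp (I.indicator g) 2 volume := (memLp_indicator_iff_restrict hI).2 hg
  have hGn : MemLp (fun x => ‖I.indicator g x‖) 2 volume := hG.norm
  have hG1 : IntegrableOn (fun x => ‖I.indicator g x‖) (Ioc s t) :=
    (hGn.restrict _).integrable (by norm_num)
  set A := ∫ x in Ioc s t, ‖I.indicator g x‖ with hA
  have hA0 : 0 ≤ A := integral_nonneg fun _ => norm_nonneg _
  have hF2 : IntegrableOn (fun x => ‖F x‖ ^ 2) I := hF.norm.integrable_sq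
  have hA2 : A ^ 2 ≤ (t - s) * ∫ x in I, ‖g x‖ ^ 2 := by
    refine (sq_integral_le hst (hGn.restrict _)).trans ?_
    refine mul_le_mul_of_nonneg_left ?_ hts.le
    refine (setIntegral_le_integral hGn.integrable_sq
      (ae_of_all _ fun x => by positivity)).trans_eq ?_
    rw [← integral_indicator hI]
    congr 1
    ext x
    by_cases hx : x ∈ I <;> simp [hx]
  have hpt : ∀ x ∈ Ioo s t, ‖F p‖ ^ 2 ≤ 2 * ‖F x‖ ^ 2 + 2 * A ^ 2 := by
    intro x hx
    have h1 : ‖F p - F x‖ ≤ A := by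
      rw [hFg x p]
      refine intervalIntegral.norm_integral_le_integral_norm_uIoc.trans ?_
      refine setIntegral_mono_set hG1 (ae_of_all _ fun _ => norm_nonneg _) ?_
      refine LE.le.eventuallyLE ?_
      rw [uIoc]
      exact Ioc_subset_Ioc (le_min hx.1.le hp.1) (max_le hx.2.le hp.2)
    have h2 : ‖F p‖ ≤ ‖F x‖ + A := by
      have := norm_sub_norm_le (F p) (F x)
      linarith
    have h3 : ‖F p‖ ^ 2 ≤ (‖F x‖ + A) ^ 2 := pow_le_pow_left₀ (norm_nonneg _) h2 2
    nlinarith [sq_nonneg (‖F x‖ - A)]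
  have hFo : IntegrableOn (fun x => ‖F x‖ ^ 2) (Ioo s t) := hF2.mono_set hsub
  have hfin : volume (Ioo s t) ≠ ⊤ := by simp
  have h4 : ∫ _ in Ioo s t, ‖F p‖ ^ 2 ≤ ∫ x in Ioo s t, (2 * ‖F x‖ ^ 2 + 2 * A ^ 2) :=
    setIntegral_mono_on (integrableOn_const hfin)
      (Integrable.add (hFo.const_mul 2) (integrableOn_const hfin)) measurableSet_Ioo hpt
  rw [integral_add (hFo.const_mul 2) (integrableOn_const hfin), setIntegral_const,
    setIntegral_const, integral_const_mul, hv, smul_eq_mul, smul_eq_mul] at h4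
  have h5 : ∫ x in Ioo s t, ‖F x‖ ^ 2 ≤ ∫ x in I, ‖F x‖ ^ 2 :=
    setIntegral_mono_set hF2 (ae_of_all _ fun _ => by positivity) hsub.eventuallyLE
  nlinarith [mul_le_mul_of_nonneg_left hA2 hts.le]

lemma norm_sq_eq_integral {μ : Measure ℝ} (f : Lp 𝕜 2 μ) : ‖f‖ ^ 2 = ∫ x, ‖f x‖ ^ 2 ∂μ := by
  rw [← inner_self_eq_norm_sq (𝕜 := 𝕜) f, L2.inner_def, ← integral_re (L2.integrable_inner f f)]
  simp_rw [inner_self_eq_norm_sq]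

lemma HasWeakDeriv.congr_ae {I : Set ℝ} {f f' g g' : ℝ → 𝕜} (h : HasWeakDeriv I f g)
    (hf : f =ᵐ[volume.restrict I] f') (hg : g =ᵐ[volume.restrict I] g') :
    HasWeakDeriv I f' g' := fun φ hφ hc hI => by
  rw [← integral_congr_ae (hf.mono fun x hx => show deriv φ x • f x = deriv φ x • f' x by rw [hx]), h φ hφ hc hI,
    integral_congr_ae (hg.mono fun x hx => show φ x • g x = φ x • g' x by rw [hx])]

lemma HasWeakDeriv.zero {I : Set ℝ} :
    HasWeakDeriv I (0 : Lp 𝕜 2 (volume.restrict I)) (0 : Lp 𝕜 2 (volume.restrict I)) :=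
  HasWeakDeriv.congr_ae (f := 0) (g := 0) (fun φ _ _ _ => by simp)
    (Lp.coeFn_zero _ _ _).symm (Lp.coeFn_zero _ _ _).symm

lemma HasWeakDeriv.add {I : Set ℝ} {f f' g g' : Lp 𝕜 2 (volume.restrict I)}
    (h : HasWeakDeriv I f g) (h' : HasWeakDeriv I f' g') :
    HasWeakDeriv I (f + f' : Lp 𝕜 2 (volume.restrict I)) (g + g' : Lp 𝕜 2 (volume.restrict I)) := by
  refine HasWeakDeriv.congr_ae (f := (f : ℝ → 𝕜) + (f' : ℝ → 𝕜))
    (g := (g : ℝ → 𝕜) + (g' : ℝ → 𝕜)) (fun φ hφ hc hI => ?_)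
    (Lp.coeFn_add f f').symm (Lp.coeFn_add g g').symm
  have hφ1 : ContDiff ℝ 1 φ := hφ.of_le (by exact_mod_cast le_top)
  have hdc : Continuous (deriv φ) := hφ1.continuous_deriv (by norm_num)
  simp_rw [Pi.add_apply, smul_add]
  rw [integral_add (integrableOn_smul (Lp.memLp f) hdc hc.deriv)
      (integrableOn_smul (Lp.memLp f') hdc hc.deriv),
    integral_add (integrableOn_smul (Lp.memLp g) hφ.continuous hc)
      (integrableOn_smul (Lp.memLp g') hφ.continuous hc), h φ hφ hc hI, h' φ hφ hc hI, neg_add]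

lemma HasWeakDeriv.smul {I : Set ℝ} (c : 𝕜) {f g : Lp 𝕜 2 (volume.restrict I)}
    (h : HasWeakDeriv I f g) :
    HasWeakDeriv I (c • f : Lp 𝕜 2 (volume.restrict I)) (c • g : Lp 𝕜 2 (volume.restrict I)) := by
  refine HasWeakDeriv.congr_ae (f := c • (f : ℝ → 𝕜)) (g := c • (g : ℝ → 𝕜)) (fun φ hφ hc hI => ?_)
    (Lp.coeFn_smul c f).symm (Lp.coeFn_smul c g).symm
  simp_rw [Pi.smul_apply, smul_comm _ c]
  rw [integral_smul, integral_smul, h φ hφ hc hI, smul_neg]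

lemma HasWeakDeriv.unique {I : Set ℝ} (hI : IsOpen I) {f g g' : Lp 𝕜 2 (volume.restrict I)}
    (h : HasWeakDeriv I f g) (h' : HasWeakDeriv I f g') : g = g' :=
  Lp.ext (h.ae_unique hI (Lp.memLp g) (Lp.memLp g') h')

open Classical in
/-- The continuous representative of `f`: a function that is continuous on the closure of `I` and
agrees with `f` almost everywhere on `I` (and `0` if there is none). For open `I` its values on the
closure of `I` are uniquely determined. -/
noncomputable def contRep (I : Set ℝ) (f : ℝ → 𝕜) : ℝ → 𝕜 :=
  if h : ∃ F : ℝ → 𝕜, ContinuousOn F (closure I) ∧ F =ᵐ[volume.restrict I] f then h.choose else 0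

lemma contRep_eq {I : Set ℝ} (hI : IsOpen I) {f F : ℝ → 𝕜} (hF : ContinuousOn F (closure I))
    (hFf : F =ᵐ[volume.restrict I] f) : EqOn (contRep I f) F (closure I) := by
  have h : ∃ F : ℝ → 𝕜, ContinuousOn F (closure I) ∧ F =ᵐ[volume.restrict I] f := ⟨F, hF, hFf⟩
  rw [contRep, dif_pos h]
  obtain ⟨h1, h2⟩ := h.choose_spec
  exact (Measure.eqOn_open_of_ae_eq (h2.trans hFf.symm) hI (h1.mono subset_closure)
    (hF.mono subset_closure)).of_subset_closure h1 hF subset_closure subset_rfl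

end IntervalSobolev

/-- A metric graph: `V` is the set of vertices, `E` the set of edges, the edge `e` corresponds to
the interval `(a e, b e) ⊆ ℝ`, every finite left end point has a starting vertex and every finite
right end point has an end vertex. -/
structure MetricGraph (V E : Type*) where
  a : E → EReal
  b : E → EReal
  a_lt_b : ∀ e, a e < b e
  startVertex : {e : E // ⊥ < a e} → V
  endVertex : {e : E // b e < ⊤} → V

namespace MetricGraph

open IntervalSobolev
open MeasureTheory Set Filter Topology
open scoped ENNReal ContDiff

variable {V E : Type*} (Γ : MetricGraph V E) (𝕜 : Type*) [RCLike 𝕜]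

/-- The edges with a finite left end point. -/
def leftEdges : Set E := {e | ⊥ < Γ.a e}

/-- The edges with a finite right end point. -/
def rightEdges : Set E := {e | Γ.b e < ⊤}

/-- The open interval `(a e, b e)`. -/
def interval (e : E) : Set ℝ := {x | Γ.a e < x ∧ (x : EReal) < Γ.b e}

lemma isOpen_interval (e : E) : IsOpen (Γ.interval e) :=
  (isOpen_lt continuous_const continuous_coe_real_ereal).inter
    (isOpen_lt continuous_coe_real_ereal continuous_const)

lemma ordConnected_interval (e : E) : (Γ.interval e).OrdConnected :=
  ⟨fun _ hx _ hy _ hz => ⟨hx.1.trans_le (EReal.coe_le_coe_iff.2 hz.1),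
    (EReal.coe_le_coe_iff.2 hz.2).trans_lt hy.2⟩⟩

/-- The Hilbert space `⨁_{e ∈ E} L²(a e, b e)`. -/
noncomputable abbrev L2Space := lp (fun e : E => Lp 𝕜 2 (volume.restrict (Γ.interval e))) 2

variable {Γ 𝕜} in
/-- `g` is the edgewise weak derivative of `f`. -/
def IsDeriv (f g : Γ.L2Space 𝕜) : Prop := ∀ e, HasWeakDeriv (Γ.interval e) (f e) (g e)

variable {Γ 𝕜} in
lemma IsDeriv.add {f f' g g' : Γ.L2Space 𝕜} (h : IsDeriv f g) (h' : IsDeriv f' g') :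
    IsDeriv (f + f') (g + g') := fun e => (h e).add (h' e)

variable {Γ 𝕜} in
lemma IsDeriv.smul (c : 𝕜) {f g : Γ.L2Space 𝕜} (h : IsDeriv f g) :
    IsDeriv (c • f) (c • g) := fun e => (h e).smul c

variable {Γ 𝕜} in
lemma IsDeriv.unique {f g g' : Γ.L2Space 𝕜} (h : IsDeriv f g) (h' : IsDeriv f g') : g = g' :=
  lp.ext (funext fun e => (h e).unique (Γ.isOpen_interval e) (h' e))

/-- The maximal first derivative operator: its domain is `⨁_{e ∈ E} W₂¹(a e, b e)`, i.e. all
`f ∈ ⨁_e L²(a e, b e)` for which the edgewise weak derivatives exist and form an element of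
`⨁_e L²(a e, b e)`, and it maps `f` to `(f_e')_e`. -/
noncomputable def maxDeriv : Γ.L2Space 𝕜 →ₗ.[𝕜] Γ.L2Space 𝕜 where
  domain :=
    { carrier := {f | ∃ g : Γ.L2Space 𝕜, IsDeriv f g}
      zero_mem' := ⟨0, fun _ => HasWeakDeriv.zero⟩
      add_mem' := fun ⟨g, hg⟩ ⟨g', hg'⟩ => ⟨g + g', hg.add hg'⟩
      smul_mem' := fun c _ ⟨g, hg⟩ => ⟨c • g, hg.smul c⟩ }
  toFun :=
    { toFun := fun f => f.2.choose
      map_add' := fun f f' =>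
        (f + f').2.choose_spec.unique (f.2.choose_spec.add f'.2.choose_spec)
      map_smul' := fun c f => (c • f).2.choose_spec.unique (f.2.choose_spec.smul c) }

lemma maxDeriv_spec (f : (Γ.maxDeriv 𝕜).domain) : IsDeriv (f : Γ.L2Space 𝕜) (Γ.maxDeriv 𝕜 f) :=
  f.2.choose_spec

variable {Γ 𝕜}

lemma exists_rep (f : (Γ.maxDeriv 𝕜).domain) (e : E) :
    ∃ F : ℝ → 𝕜, Continuous F ∧ F =ᵐ[volume.restrict (Γ.interval e)] (f : Γ.L2Space 𝕜) e ∧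
      (∀ x y, F y - F x = ∫ t in x..y, (Γ.interval e).indicator (Γ.maxDeriv 𝕜 f e) t) ∧
      EqOn (contRep (Γ.interval e) ((f : Γ.L2Space 𝕜) e)) F (closure (Γ.interval e)) := by
  obtain ⟨F, h1, h2, h3⟩ := (Γ.maxDeriv_spec 𝕜 f e).exists_primitive (Γ.isOpen_interval e)
    (Γ.ordConnected_interval e) (Lp.memLp _) (Lp.memLp _)
  exact ⟨F, h1, h2, h3, contRep_eq (Γ.isOpen_interval e) h1.continuousOn h2⟩

lemma contRep_add (f f' : (Γ.maxDeriv 𝕜).domain) (e : E) {p : ℝ}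
    (hp : p ∈ closure (Γ.interval e)) :
    contRep (Γ.interval e) (((f + f' : (Γ.maxDeriv 𝕜).domain) : Γ.L2Space 𝕜) e) p =
      contRep (Γ.interval e) ((f : Γ.L2Space 𝕜) e) p +
        contRep (Γ.interval e) ((f' : Γ.L2Space 𝕜) e) p := by
  obtain ⟨F, h1, h2, -, h4⟩ := exists_rep f e
  obtain ⟨F', h1', h2', -, h4'⟩ := exists_rep f' e
  rw [h4 hp, h4' hp]
  refine contRep_eq (F := F + F') (Γ.isOpen_interval e) (h1.add h1').continuousOn ?_ hp
  exact (h2.add h2').trans (Lp.coeFn_add _ _).symm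

lemma contRep_smul (c : 𝕜) (f : (Γ.maxDeriv 𝕜).domain) (e : E) {p : ℝ}
    (hp : p ∈ closure (Γ.interval e)) :
    contRep (Γ.interval e) (((c • f : (Γ.maxDeriv 𝕜).domain) : Γ.L2Space 𝕜) e) p =
      c • contRep (Γ.interval e) ((f : Γ.L2Space 𝕜) e) p := by
  obtain ⟨F, h1, h2, -, h4⟩ := exists_rep f e
  rw [h4 hp]
  refine contRep_eq (F := c • F) (Γ.isOpen_interval e) (h1.const_smul c).continuousOn ?_ hp
  exact (h2.const_smul c).trans (Lp.coeFn_smul _ _).symm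

lemma sq_norm_contRep_le {l : ℝ} (hl : 0 < l) (f : (Γ.maxDeriv 𝕜).domain) (e : E) {s p : ℝ}
    (hs : Ioo s (s + l) ⊆ Γ.interval e) (hp : p ∈ Icc s (s + l)) :
    ‖contRep (Γ.interval e) ((f : Γ.L2Space 𝕜) e) p‖ ^ 2 ≤
      (2 / l) * ‖(f : Γ.L2Space 𝕜) e‖ ^ 2 + (2 * l) * ‖Γ.maxDeriv 𝕜 f e‖ ^ 2 := by
  obtain ⟨F, h1, h2, h3, h4⟩ := exists_rep f e
  have hcl : p ∈ closure (Γ.interval e) := by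
    refine closure_mono hs ?_
    rwa [closure_Ioo (by linarith)]
  have h := sq_norm_apply_le (Γ.isOpen_interval e).measurableSet
    ((memLp_congr_ae h2).2 (Lp.memLp _)) (Lp.memLp _) h3 (by linarith) hs hp
  rw [integral_congr_ae (g := fun x => ‖(f : Γ.L2Space 𝕜) e x‖ ^ 2)
    (h2.mono fun x hx => by simp only [hx]), ← norm_sq_eq_integral, ← norm_sq_eq_integral,
    add_sub_cancel_left] at h
  rw [h4 hcl]
  have : (2 / l) * ‖(f : Γ.L2Space 𝕜) e‖ ^ 2 + (2 * l) * ‖Γ.maxDeriv 𝕜 f e‖ ^ 2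
      = (2 * ‖(f : Γ.L2Space 𝕜) e‖ ^ 2 + 2 * l ^ 2 * ‖Γ.maxDeriv 𝕜 f e‖ ^ 2) / l := by
    field_simp
  rw [this, le_div_iff₀ hl]
  linarith

lemma memℓp_contRep {S : Set E} {p : S → ℝ} {l : ℝ} (hl : 0 < l)
    (hp : ∀ e : S, ∃ s, Ioo s (s + l) ⊆ Γ.interval e ∧ p e ∈ Icc s (s + l))
    (f : (Γ.maxDeriv 𝕜).domain) :
    Memℓp (fun e : S => contRep (Γ.interval e) ((f : Γ.L2Space 𝕜) e) (p e)) 2 := by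
  have key : ∀ u : Γ.L2Space 𝕜, Summable fun e : S => ‖u e‖ ^ 2 := fun u => by
    have := (lp.memℓp u).summable (by norm_num)
    simp only [ENNReal.toReal_ofNat, Real.rpow_ofNat] at this
    exact this.comp_injective Subtype.val_injective
  refine memℓp_gen ?_
  simp only [ENNReal.toReal_ofNat, Real.rpow_ofNat]
  refine Summable.of_nonneg_of_le (fun _ => by positivity) (fun e => ?_)
    (((key f).mul_left (2 / l)).add ((key (Γ.maxDeriv 𝕜 f)).mul_left (2 * l)))
  obtain ⟨s, hs, hps⟩ := hp e
  exact sq_norm_contRep_le hl f e hs hps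

lemma exists_length (hΓ : 0 < ⨅ e, (Γ.b e - Γ.a e)) :
    ∃ l : ℝ, 0 < l ∧ ∀ e, (l : EReal) ≤ Γ.b e - Γ.a e := by
  obtain ⟨l, h0, h1⟩ := EReal.lt_iff_exists_real_btwn.1 hΓ
  exact ⟨l, by exact_mod_cast h0, fun e => h1.le.trans (iInf_le _ e)⟩

lemma exists_left {l : ℝ} (hl : 0 < l) (h : ∀ e, (l : EReal) ≤ Γ.b e - Γ.a e)
    (e : Γ.leftEdges) :
    ∃ s, Ioo s (s + l) ⊆ Γ.interval e ∧ (Γ.a e).toReal ∈ Icc s (s + l) := by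
  refine ⟨(Γ.a e).toReal, fun x hx => ?_, le_rfl, by linarith⟩
  have ha : ⊥ < Γ.a e := e.2
  have hab := Γ.a_lt_b e
  have hle := h e
  simp only [interval, mem_ofPred_eq]
  generalize Γ.a e = α at *
  generalize Γ.b e = β at *
  induction α with
  | bot => exact absurd ha (lt_irrefl _)
  | top => exact absurd hab not_top_lt
  | coe α =>
    rw [EReal.toReal_coe] at hx
    refine ⟨EReal.coe_lt_coe_iff.2 hx.1, ?_⟩
    induction β with
    | bot => exact absurd hab not_lt_bot
    | top => exact EReal.coe_lt_top x
    | coe β =>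
      rw [← EReal.coe_sub, EReal.coe_le_coe_iff] at hle
      exact EReal.coe_lt_coe_iff.2 (by linarith [hx.2])

lemma exists_right {l : ℝ} (hl : 0 < l) (h : ∀ e, (l : EReal) ≤ Γ.b e - Γ.a e)
    (e : Γ.rightEdges) :
    ∃ s, Ioo s (s + l) ⊆ Γ.interval e ∧ (Γ.b e).toReal ∈ Icc s (s + l) := by
  refine ⟨(Γ.b e).toReal - l, fun x hx => ?_, by linarith, by linarith⟩
  have hb : Γ.b e < ⊤ := e.2
  have hab := Γ.a_lt_b e
  have hle := h e
  simp only [interval, mem_ofPred_eq]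
  generalize Γ.a e = α at *
  generalize Γ.b e = β at *
  induction β with
  | bot => exact absurd hab not_lt_bot
  | top => exact absurd hb (lt_irrefl _)
  | coe β =>
    rw [EReal.toReal_coe] at hx
    refine ⟨?_, EReal.coe_lt_coe_iff.2 (by linarith [hx.2])⟩
    induction α with
    | bot => exact EReal.bot_lt_coe x
    | top => exact absurd hab not_top_lt
    | coe α =>
      rw [← EReal.coe_sub, EReal.coe_le_coe_iff] at hle
      exact EReal.coe_lt_coe_iff.2 (by linarith [hx.1])

lemma mem_closure {l : ℝ} (hl : 0 < l) {e : E} {p : ℝ}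
    (hp : ∃ s, Ioo s (s + l) ⊆ Γ.interval e ∧ p ∈ Icc s (s + l)) :
    p ∈ closure (Γ.interval e) := by
  obtain ⟨s, hs, hp⟩ := hp
  refine closure_mono hs ?_
  rwa [closure_Ioo (by linarith)]

variable (Γ 𝕜)

/-- The trace `f ↦ (f_e(a e))_e` from `⨁_e W₂¹(a e, b e)` to `ℓ²`, at the finite left end points. -/
noncomputable def leftTrace (hΓ : 0 < ⨅ e, (Γ.b e - Γ.a e)) :
    (Γ.maxDeriv 𝕜).domain →ₗ[𝕜] lp (fun _ : Γ.leftEdges => 𝕜) 2 where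
  toFun f := ⟨fun e => contRep (Γ.interval e) ((f : Γ.L2Space 𝕜) e) (Γ.a e).toReal, by
    obtain ⟨l, hl, h⟩ := exists_length hΓ
    exact memℓp_contRep hl (exists_left hl h) f⟩
  map_add' f f' := by
    obtain ⟨l, hl, h⟩ := exists_length hΓ
    exact lp.ext (funext fun e => contRep_add f f' e (mem_closure hl (exists_left hl h e)))
  map_smul' c f := by
    obtain ⟨l, hl, h⟩ := exists_length hΓ
    exact lp.ext (funext fun e => contRep_smul c f e (mem_closure hl (exists_left hl h e)))

/-- The trace `f ↦ (f_e(b e))_e` from `⨁_e W₂¹(a e, b e)` to `ℓ²`, at the finite right end points. -/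
noncomputable def rightTrace (hΓ : 0 < ⨅ e, (Γ.b e - Γ.a e)) :
    (Γ.maxDeriv 𝕜).domain →ₗ[𝕜] lp (fun _ : Γ.rightEdges => 𝕜) 2 where
  toFun f := ⟨fun e => contRep (Γ.interval e) ((f : Γ.L2Space 𝕜) e) (Γ.b e).toReal, by
    obtain ⟨l, hl, h⟩ := exists_length hΓ
    exact memℓp_contRep hl (exists_right hl h) f⟩
  map_add' f f' := by
    obtain ⟨l, hl, h⟩ := exists_length hΓ
    exact lp.ext (funext fun e => contRep_add f f' e (mem_closure hl (exists_right hl h e)))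
  map_smul' c f := by
    obtain ⟨l, hl, h⟩ := exists_length hΓ
    exact lp.ext (funext fun e => contRep_smul c f e (mem_closure hl (exists_right hl h e)))

end MetricGraph

/-- A linear relation `M ⊆ X ⊕ X` is skew-self-adjoint if `M = S M*`, where `S (x, y) = (x, -y)`
and `M*` is the adjoint relation. -/
def Submodule.IsSkewSelfAdjoint {𝕜 X : Type*} [RCLike 𝕜] [NormedAddCommGroup X]
    [InnerProductSpace 𝕜 X] (M : Submodule 𝕜 (X × X)) : Prop :=
  M = M.adjoint.map (LinearMap.prodMap LinearMap.id (-LinearMap.id))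

/-- A linear operator is skew-self-adjoint if its graph is. -/
def LinearPMap.IsSkewSelfAdjoint {𝕜 X : Type*} [RCLike 𝕜] [NormedAddCommGroup X]
    [InnerProductSpace 𝕜 X] (H : X →ₗ.[𝕜] X) : Prop :=
  H.graph.IsSkewSelfAdjoint

/-! Write `R` and `S` for the traces at the right and left end points and `A` for the maximal
operator. Integration by parts on each edge, summed over all edges, gives Green's formula `⟪A f, g⟫
+ ⟪f, A g⟫ = ⟪R f, R g⟫ - ⟪S f, S g⟫` (`inner_maxDeriv_add_inner_maxDeriv`). Skew-self-adjointness
of `H` says that `(y, x)` lies in the graph exactly when `⟪H u, y⟫ + ⟪u, x⟫ = 0` for all `u` in the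
domain. For `f` in the domain of `A` this becomes a condition on boundary values alone.

If `H` is skew-self-adjoint, joint surjectivity of the traces
(`exists_rightTrace_eq_and_leftTrace_eq`) shows that the space `M` of boundary values of `H` is its
own orthogonal complement for the form `⟪ξ, ξ'⟫ - ⟪η, η'⟫`. Elements of `M` then have components of
equal norm, so both projections of `M` are isometric. They are also onto: a vector `ξ` orthogonal to
the first components gives `(ξ, 0) ∈ M`, hence `ξ = 0`, and likewise for the second. Thus `M` is the
graph of a unitary.

Conversely, let the domain be given by a unitary `L`. Green's formula shows that the graph pairs to
zero with itself. If `(y, x)` pairs to zero with the graph, testing with smooth functions compactly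
supported in one edge gives `x = y'` weakly (`isDeriv_of_forall_inner`), so `y` has traces. Green's
formula, with test functions whose traces are `(ξ, L ξ)` for arbitrary `ξ`, then forces `L (R y) = S
y`.

The lower bound on edge lengths makes the traces square summable and lets the values at the two ends
of an edge be prescribed independently. -/

/-! ### Self-orthogonal subspaces and unitary operators -/

/-- A maximal isotropic subspace, with respect to the form `⟪x, x'⟫ - ⟪y, y'⟫` on `X × Y`, is the
graph of a unitary operator. -/
theorem exists_linearIsometryEquiv_of_forall_mem_iff {𝕜 X Y : Type*} [RCLike 𝕜]
    [NormedAddCommGroup X] [InnerProductSpace 𝕜 X] [CompleteSpace X]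
    [NormedAddCommGroup Y] [InnerProductSpace 𝕜 Y] [CompleteSpace Y] (M : Submodule 𝕜 (X × Y))
    (hM : ∀ p : X × Y, p ∈ M ↔ ∀ q ∈ M, inner 𝕜 q.1 p.1 = inner 𝕜 q.2 p.2) :
    ∃ L : X ≃ₗᵢ[𝕜] Y, ∀ p : X × Y, p ∈ M ↔ L p.1 = p.2 := by
  have hnorm : ∀ p ∈ M, ‖p.1‖ = ‖p.2‖ := fun p hp => by
    have h := (hM p).1 hp p hp
    rw [inner_self_eq_norm_sq_to_K, inner_self_eq_norm_sq_to_K] at h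
    exact (sq_eq_sq₀ (norm_nonneg _) (norm_nonneg _)).1 (by exact_mod_cast h)
  -- `M` is cut out by continuous equations. Its completeness makes the ranges of the two isometric
  -- projections closed, so surjectivity can be tested on orthogonal complements.
  have hclosed : IsClosed (M : Set (X × Y)) := by
    have : (M : Set (X × Y)) =
        ⋂ q ∈ M, {p : X × Y | inner 𝕜 q.1 p.1 = inner 𝕜 q.2 p.2} := by
      ext p; simp only [SetLike.mem_coe, hM p, Set.mem_iInter, Set.mem_ofPred_eq]
    rw [this]
    exact isClosed_biInter fun q _ => isClosed_eq (by fun_prop) (by fun_prop)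
  have : CompleteSpace M := hclosed.completeSpace_coe
  -- The product carries the maximum norm; on `M` both components have the same norm, so this
  -- maximum equals either of them.
  let P : M →ₗᵢ[𝕜] X := ⟨(LinearMap.fst 𝕜 X Y).comp M.subtype, fun m => by
    simpa [Prod.norm_def] using (hnorm m m.2).ge⟩
  let Q : M →ₗᵢ[𝕜] Y := ⟨(LinearMap.snd 𝕜 X Y).comp M.subtype, fun m => by
    simpa [Prod.norm_def] using (hnorm m m.2).le⟩
  have hP : Function.Surjective P := by
    rw [← LinearIsometry.coe_toLinearMap, ← LinearMap.range_eq_top]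
    have : CompleteSpace (LinearMap.range P.toLinearMap) :=
      P.isometry.isClosedEmbedding.isClosed_range.completeSpace_coe
    rw [← Submodule.orthogonal_eq_bot_iff, Submodule.eq_bot_iff]
    intro x hx
    -- Maximality: `(x, 0)` pairs to zero with all of `M`, so it lies in `M`, and equality of norms
    -- gives `x = 0`.
    have h : (x, (0 : Y)) ∈ M := (hM _).2 fun q hq => by
      rw [inner_zero_right]
      exact (Submodule.mem_orthogonal _ _).1 hx q.1 ⟨⟨q, hq⟩, rfl⟩
    simpa using hnorm _ h
  have hQ : Function.Surjective Q := by
    rw [← LinearIsometry.coe_toLinearMap, ← LinearMap.range_eq_top]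
    have : CompleteSpace (LinearMap.range Q.toLinearMap) :=
      Q.isometry.isClosedEmbedding.isClosed_range.completeSpace_coe
    rw [← Submodule.orthogonal_eq_bot_iff, Submodule.eq_bot_iff]
    intro y hy
    have h : ((0 : X), y) ∈ M := (hM _).2 fun q hq => by
      rw [inner_zero_right]
      exact ((Submodule.mem_orthogonal _ _).1 hy q.2 ⟨⟨q, hq⟩, rfl⟩).symm
    simpa using (hnorm _ h).symm
  let P' := LinearIsometryEquiv.ofSurjective P hP
  let Q' := LinearIsometryEquiv.ofSurjective Q hQ
  refine ⟨P'.symm.trans Q', fun p => ⟨fun hp => ?_, fun hp => ?_⟩⟩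
  · have : P'.symm p.1 = ⟨p, hp⟩ := by
      rw [LinearIsometryEquiv.symm_apply_eq]; rfl
    rw [LinearIsometryEquiv.trans_apply, this]; rfl
  · have h : p = (P'.symm p.1 : M) := Prod.ext (P'.apply_symm_apply p.1).symm hp.symm
    rw [h]
    exact (P'.symm p.1).2

/-! ### Product rule and fundamental theorem for primitives -/

namespace IntervalSobolev

open MeasureTheory Set Filter Topology
open scoped ENNReal ContDiff

variable {𝕜 : Type*} [RCLike 𝕜]

/-- Each increment of `F` is bounded by the corresponding increment of the primitive of `‖f‖`, so
the absolute continuity of that real-valued primitive carries over. -/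
lemma absolutelyContinuousOnInterval_of_primitive {F f : ℝ → 𝕜} (hf : LocallyIntegrable f volume)
    (hF : ∀ x y, F y - F x = ∫ t in x..y, f t) (a b : ℝ) :
    AbsolutelyContinuousOnInterval F a b := by
  have hi : ∀ x y, IntervalIntegrable (fun t => ‖f t‖) volume x y := fun x y =>
    ((hf.integrableOn_isCompact isCompact_uIcc).intervalIntegrable).norm
  have h := (hi a b).absolutelyContinuousOnInterval_intervalIntegral (c := a) left_mem_uIcc
  refine squeeze_zero (fun _ => Finset.sum_nonneg fun _ _ => dist_nonneg) (fun u => ?_) h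
  refine Finset.sum_le_sum fun i _ => ?_
  rw [dist_comm, dist_eq_norm, hF, dist_comm, Real.dist_eq,
    intervalIntegral.integral_interval_sub_left (hi _ _) (hi _ _)]
  exact intervalIntegral.norm_integral_le_abs_integral_norm

lemma continuous_of_primitive {F f : ℝ → 𝕜} (hf : LocallyIntegrable f volume)
    (hF : ∀ x y, F y - F x = ∫ t in x..y, f t) : Continuous F := by
  have : F = fun x => F 0 + ∫ t in (0 : ℝ)..x, f t := funext fun x => by rw [← hF]; ring
  rw [this]
  exact continuous_const.add (intervalIntegral.continuous_primitive
    (fun a b => (hf.integrableOn_isCompact isCompact_uIcc).intervalIntegrable) 0)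

/-- The product rule for primitives of locally integrable functions. -/
lemma mul_sub_mul_eq_integral {F G f g : ℝ → 𝕜} (hf : LocallyIntegrable f volume)
    (hg : LocallyIntegrable g volume) (hF : ∀ x y, F y - F x = ∫ t in x..y, f t)
    (hG : ∀ x y, G y - G x = ∫ t in x..y, g t) (x y : ℝ) :
    F y * G y - F x * G x = ∫ t in x..y, (f t * G t + F t * g t) := by
  have hFc := continuous_of_primitive hf hF
  have hGc := continuous_of_primitive hg hG
  have hk : LocallyIntegrable (fun t => f t * G t + F t * g t) volume := by
    refine LocallyIntegrable.add ?_ ?_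
    · simpa only [smul_eq_mul, mul_comm] using hf.continuous_smul hGc
    · simpa only [smul_eq_mul] using hg.continuous_smul hFc
  have hi : ∀ a b, IntervalIntegrable (fun t => f t * G t + F t * g t) volume a b := fun a b =>
    (hk.integrableOn_isCompact isCompact_uIcc).intervalIntegrable
  -- The difference of `F * G` and the primitive of `f * G + F * g` is absolutely continuous and, by
  -- Lebesgue differentiation, has derivative zero almost everywhere; hence it is constant. The
  -- primitive starts at `x`, where it vanishes.
  have hac := ((absolutelyContinuousOnInterval_of_primitive hf hF x y).smul
    (absolutelyContinuousOnInterval_of_primitive hg hG x y)).sub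
    (absolutelyContinuousOnInterval_of_primitive hk (F := fun z => ∫ t in x..z,
      (f t * G t + F t * g t))
      (fun a b => intervalIntegral.integral_interval_sub_left (hi _ _) (hi _ _)) x y)
  have hder : ∀ {F f : ℝ → 𝕜} {z : ℝ}, (∀ x y, F y - F x = ∫ t in x..y, f t) →
      (∀ c, HasDerivAt (fun x => ∫ t in c..x, f t) (f z) z) → HasDerivAt F (f z) z := by
    intro F f z hF h
    have : F = fun x => F 0 + ∫ t in (0 : ℝ)..x, f t := funext fun x => by rw [← hF]; ring
    rw [this]
    exact (h 0).const_add _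
  obtain ⟨C, hC⟩ := hac.const_of_ae_hasDerivAt_zero (by
    filter_upwards [_root_.LocallyIntegrable.ae_hasDerivAt_integral hf,
      _root_.LocallyIntegrable.ae_hasDerivAt_integral hg,
      _root_.LocallyIntegrable.ae_hasDerivAt_integral hk] with z h1 h2 h3 _
    have := ((hder hF h1).mul (hder hG h2)).sub (h3 x)
    rwa [sub_self] at this)
  have hx := hC x left_mem_uIcc
  have hy := hC y right_mem_uIcc
  simp only [Pi.sub_apply, smul_eq_mul, Pi.mul_apply, intervalIntegral.integral_same,
    sub_zero] at hx hy
  rw [hx, ← hy]; ring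

/-- The integral over an interval of the derivative of an integrable function. -/
lemma integral_eq_sub_of_primitive {a b : EReal} (hab : a < b) {h k : ℝ → 𝕜}
    (hh : IntegrableOn h {x : ℝ | a < x ∧ (x : EReal) < b})
    (hk : IntegrableOn k {x : ℝ | a < x ∧ (x : EReal) < b})
    (H : ∀ x y, h y - h x = ∫ t in x..y, {x : ℝ | a < x ∧ (x : EReal) < b}.indicator k t) :
    ∫ x in {x : ℝ | a < x ∧ (x : EReal) < b}, k x =
      (if b < ⊤ then h b.toReal else 0) - (if ⊥ < a then h a.toReal else 0) := by
  set I := {x : ℝ | a < x ∧ (x : EReal) < b} with hI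
  have hIm : MeasurableSet I := ((isOpen_lt continuous_const continuous_coe_real_ereal).inter
    (isOpen_lt continuous_coe_real_ereal continuous_const)).measurableSet
  have hki : Integrable (I.indicator k) := (integrable_indicator_iff hIm).2 hk
  have hi : ∀ x y, IntervalIntegrable (I.indicator k) volume x y := fun x y =>
    hki.intervalIntegrable
  have h0 : ∀ x, h x = h 0 + ∫ t in (0 : ℝ)..x, I.indicator k t := fun x => by rw [← H]; ring
  -- Since `I.indicator k` is integrable on the line, `h` has limits at both infinities, and the
  -- integral of `k` over `I` is their difference.
  have htop : Tendsto h atTop (𝓝 (h 0 + ∫ t in Ioi 0, I.indicator k t)) := by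
    rw [funext h0]
    simpa using tendsto_const_nhds.add
      (intervalIntegral_tendsto_integral_Ioi 0 hki.integrableOn tendsto_id)
  have hbot : Tendsto h atBot (𝓝 (h 0 - ∫ t in Iic 0, I.indicator k t)) := by
    rw [funext h0]
    simpa [intervalIntegral.integral_symm _ (0 : ℝ), sub_eq_add_neg] using
      tendsto_const_nhds.add
      (intervalIntegral_tendsto_integral_Iic 0 hki.integrableOn tendsto_id).neg
  have hsum : ∫ x in I, k x = (h 0 + ∫ t in Ioi 0, I.indicator k t) -
      (h 0 - ∫ t in Iic 0, I.indicator k t) := by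
    rw [← integral_indicator hIm, ← intervalIntegral.integral_Iic_add_Ioi hki.integrableOn
      hki.integrableOn (b := 0)]
    ring
  rw [hsum]
  obtain ⟨c, hac, hcb⟩ := EReal.lt_iff_exists_real_btwn.1 hab
  congr 1
  · split_ifs with hb
    -- Beyond a finite end point the indicator vanishes, so `h` stays at its end point value.
    · refine tendsto_nhds_unique htop (tendsto_const_nhds.congr' ?_)
      filter_upwards [eventually_ge_atTop b.toReal] with y hy
      rw [← sub_eq_zero, ← neg_sub, H, neg_eq_zero, intervalIntegral.integral_of_le hy]
      refine setIntegral_eq_zero_of_forall_eq_zero fun t ht => indicator_of_notMem ?_ _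
      rintro ⟨-, h2⟩
      rw [← EReal.coe_toReal hb.ne (ne_bot_of_gt hab)] at h2
      exact absurd (EReal.coe_lt_coe_iff.1 h2) (not_lt.2 ht.1.le)
    -- At an infinite end point `h` is integrable on a half-line and has a limit, which must be `0`.
    · have hb' : b = ⊤ := not_lt_top_iff.1 hb
      refine IntegrableAtFilter.eq_zero_of_tendsto (μ := volume)
        ⟨Ioi c, Ioi_mem_atTop c, hh.mono_set fun x hx =>
          ⟨hac.trans (EReal.coe_lt_coe_iff.2 hx), hb' ▸ EReal.coe_lt_top x⟩⟩ (fun s hs => ?_) htop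
      obtain ⟨d, hd⟩ := mem_atTop_sets.1 hs
      rw [← top_le_iff, ← Real.volume_Ici (a := d)]
      exact measure_mono hd
  · split_ifs with ha
    · refine tendsto_nhds_unique hbot (tendsto_const_nhds.congr' ?_)
      filter_upwards [eventually_le_atBot a.toReal] with y hy
      rw [← sub_eq_zero, H, intervalIntegral.integral_of_le hy]
      refine setIntegral_eq_zero_of_forall_eq_zero fun t ht => indicator_of_notMem ?_ _
      rintro ⟨h1, -⟩
      rw [← EReal.coe_toReal (ne_top_of_lt hab) ha.ne'] at h1
      exact absurd (EReal.coe_lt_coe_iff.1 h1) (not_lt.2 ht.2)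
    · have ha' : a = ⊥ := not_bot_lt_iff.1 ha
      refine IntegrableAtFilter.eq_zero_of_tendsto (μ := volume)
        ⟨Iio c, Iio_mem_atBot c, hh.mono_set fun x hx =>
          ⟨ha' ▸ EReal.bot_lt_coe x, (EReal.coe_lt_coe_iff.2 hx).trans hcb⟩⟩ (fun s hs => ?_) hbot
      obtain ⟨d, hd⟩ := mem_atBot_sets.1 hs
      rw [← top_le_iff, ← Real.volume_Iic (a := d)]
      exact measure_mono hd

end IntervalSobolev

/-! ### Green's formula, surjectivity of the traces, and the minimal operator -/

namespace MetricGraph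

open IntervalSobolev
open MeasureTheory Set Filter Topology
open scoped ENNReal ContDiff

variable {V E : Type*} {Γ : MetricGraph V E} {𝕜 : Type*} [RCLike 𝕜]

/-- Green's formula on a single edge. -/
lemma inner_add_inner_eq_sub (hΓ : 0 < ⨅ e, (Γ.b e - Γ.a e)) (f g : (Γ.maxDeriv 𝕜).domain)
    (e : E) :
    inner 𝕜 (Γ.maxDeriv 𝕜 f e) ((g : Γ.L2Space 𝕜) e) +
        inner 𝕜 ((f : Γ.L2Space 𝕜) e) (Γ.maxDeriv 𝕜 g e) =
      (Γ.rightEdges.indicator (fun e =>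
        inner 𝕜 (contRep (Γ.interval e) ((f : Γ.L2Space 𝕜) e) (Γ.b e).toReal)
          (contRep (Γ.interval e) ((g : Γ.L2Space 𝕜) e) (Γ.b e).toReal)) e) -
      (Γ.leftEdges.indicator (fun e =>
        inner 𝕜 (contRep (Γ.interval e) ((f : Γ.L2Space 𝕜) e) (Γ.a e).toReal)
          (contRep (Γ.interval e) ((g : Γ.L2Space 𝕜) e) (Γ.a e).toReal)) e) := by
  obtain ⟨l, hl, hle⟩ := exists_length hΓ
  obtain ⟨F, -, hF, hFd, hFr⟩ := exists_rep f e
  obtain ⟨G, -, hG, hGd, hGr⟩ := exists_rep g e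
  have hIm := (Γ.isOpen_interval e).measurableSet
  have hloc : ∀ u : Lp 𝕜 2 (volume.restrict (Γ.interval e)),
      LocallyIntegrable ((Γ.interval e).indicator u) volume := fun u =>
    ((memLp_indicator_iff_restrict hIm).2 (Lp.memLp u)).locallyIntegrable (by norm_num)
  have h1 : (fun x => inner 𝕜 (F x) (G x)) =ᵐ[volume.restrict (Γ.interval e)]
      fun x => inner 𝕜 ((f : Γ.L2Space 𝕜) e x) ((g : Γ.L2Space 𝕜) e x) := by
    filter_upwards [hF, hG] with x hx hx'
    rw [hx, hx']
  have h2 : (fun x => inner 𝕜 (Γ.maxDeriv 𝕜 f e x) (G x) + inner 𝕜 (F x) (Γ.maxDeriv 𝕜 g e x))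
      =ᵐ[volume.restrict (Γ.interval e)]
      fun x => inner 𝕜 (Γ.maxDeriv 𝕜 f e x) ((g : Γ.L2Space 𝕜) e x) +
        inner 𝕜 ((f : Γ.L2Space 𝕜) e x) (Γ.maxDeriv 𝕜 g e x) := by
    filter_upwards [hF, hG] with x hx hx'
    rw [hx, hx']
  have i1 := L2.integrable_inner (𝕜 := 𝕜) (Γ.maxDeriv 𝕜 f e) ((g : Γ.L2Space 𝕜) e)
  have i2 := L2.integrable_inner (𝕜 := 𝕜) ((f : Γ.L2Space 𝕜) e) (Γ.maxDeriv 𝕜 g e)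
  -- The inner product is conjugate linear in its first entry, so the product rule is applied to
  -- `star F` and `G`.
  have hconj : ∀ x y, star (F y) - star (F x) =
      ∫ t in x..y, star ((Γ.interval e).indicator (Γ.maxDeriv 𝕜 f e) t) := fun x y => by
    rw [← star_sub, hFd]
    exact ((RCLike.conjCLE (K := 𝕜) : 𝕜 →L[ℝ] 𝕜).intervalIntegral_comp_comm
      ((hloc _).integrableOn_isCompact isCompact_uIcc).intervalIntegrable).symm
  have hprod := mul_sub_mul_eq_integral (F := fun x => star (F x))
    (f := fun t => star ((Γ.interval e).indicator (Γ.maxDeriv 𝕜 f e) t))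
    (fun x => by
      obtain ⟨s, hs, h⟩ := hloc (Γ.maxDeriv 𝕜 f e) x
      exact ⟨s, hs, (RCLike.conjCLE (K := 𝕜) : 𝕜 →L[ℝ] 𝕜).integrable_comp h⟩)
    (hloc _) hconj hGd
  -- Products of square integrable functions are integrable on the edge; this is what removes the
  -- boundary terms at infinite ends.
  have key := integral_eq_sub_of_primitive (Γ.a_lt_b e) (h := fun x => inner 𝕜 (F x) (G x))
    (k := fun x => inner 𝕜 (Γ.maxDeriv 𝕜 f e x) (G x) + inner 𝕜 (F x) (Γ.maxDeriv 𝕜 g e x))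
    ((integrable_congr h1).2 (L2.integrable_inner _ _)) ((integrable_congr h2).2 (i1.add i2))
    (fun x y => by
      have := hprod x y
      simp only [RCLike.inner_apply', ← starRingEnd_apply] at this ⊢
      rw [this]
      congr 1
      ext t
      change _ = (Γ.interval e).indicator _ t
      by_cases ht : t ∈ Γ.interval e <;> simp [ht])
  rw [L2.inner_def, L2.inner_def, ← integral_add i1 i2, ← integral_congr_ae h2]
  refine key.trans ?_
  congr 1
  · by_cases hb : e ∈ Γ.rightEdges
    · have hcl := mem_closure hl (exists_right hl hle ⟨e, hb⟩)
      refine (if_pos hb).trans ?_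
      rw [indicator_of_mem hb, hFr hcl, hGr hcl]
    · exact (if_neg hb).trans (indicator_of_notMem hb _).symm
  · by_cases ha : e ∈ Γ.leftEdges
    · have hcl := mem_closure hl (exists_left hl hle ⟨e, ha⟩)
      refine (if_pos ha).trans ?_
      rw [indicator_of_mem ha, hFr hcl, hGr hcl]
    · exact (if_neg ha).trans (indicator_of_notMem ha _).symm

/-- Green's formula. -/
lemma inner_maxDeriv_add_inner_maxDeriv (hΓ : 0 < ⨅ e, (Γ.b e - Γ.a e))
    (f g : (Γ.maxDeriv 𝕜).domain) :
    inner 𝕜 (Γ.maxDeriv 𝕜 f) (g : Γ.L2Space 𝕜) + inner 𝕜 (f : Γ.L2Space 𝕜) (Γ.maxDeriv 𝕜 g) =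
      inner 𝕜 (Γ.rightTrace 𝕜 hΓ f) (Γ.rightTrace 𝕜 hΓ g) -
        inner 𝕜 (Γ.leftTrace 𝕜 hΓ f) (Γ.leftTrace 𝕜 hΓ g) := by
  -- The boundary inner products are sums over different subsets of `E`; extending both by zero
  -- permits termwise comparison with the edgewise formula.
  have hr := (hasSum_subtype_iff_indicator (s := Γ.rightEdges) (f := fun e =>
        inner 𝕜 (contRep (Γ.interval e) ((f : Γ.L2Space 𝕜) e) (Γ.b e).toReal)
          (contRep (Γ.interval e) ((g : Γ.L2Space 𝕜) e) (Γ.b e).toReal))).1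
    (lp.hasSum_inner (𝕜 := 𝕜) (Γ.rightTrace 𝕜 hΓ f) (Γ.rightTrace 𝕜 hΓ g))
  have hl := (hasSum_subtype_iff_indicator (s := Γ.leftEdges) (f := fun e =>
        inner 𝕜 (contRep (Γ.interval e) ((f : Γ.L2Space 𝕜) e) (Γ.a e).toReal)
          (contRep (Γ.interval e) ((g : Γ.L2Space 𝕜) e) (Γ.a e).toReal))).1
    (lp.hasSum_inner (𝕜 := 𝕜) (Γ.leftTrace 𝕜 hΓ f) (Γ.leftTrace 𝕜 hΓ g))
  refine HasSum.unique ?_ (hr.sub hl)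
  simp_rw [← inner_add_inner_eq_sub hΓ f g]
  exact (lp.hasSum_inner _ _).add (lp.hasSum_inner _ _)

/-- An element of `⨁_e L²(a e, b e)` composed of translates of multiples of one function. -/
lemma exists_coe_eq_translate {ψ : ℝ → ℝ} (hψ : Continuous ψ) (hc : HasCompactSupport ψ)
    (p : E → ℝ) (c : lp (fun _ : E => 𝕜) 2) :
    ∃ f : Γ.L2Space 𝕜, ∀ e, f e =ᵐ[volume.restrict (Γ.interval e)]
      fun x => ψ (x - p e) • c e := by
  have hψ2 : MemLp ψ 2 volume := hψ.memLp_of_hasCompactSupport hc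
  -- Translation invariance makes the bound independent of `p e`, so the edge norms are dominated by
  -- a multiple of the square summable family `c`.
  have hle : ∀ e, eLpNorm (fun x => ψ (x - p e) • c e) 2 (volume.restrict (Γ.interval e)) ≤
      ENNReal.ofReal ‖c e‖ * eLpNorm ψ 2 volume := fun e => by
    refine (eLpNorm_mono_measure _ Measure.restrict_le_self).trans ?_
    rw [← eLpNorm_comp_measurePreserving hψ2.1 (measurePreserving_sub_right volume (p e))]
    refine eLpNorm_le_mul_eLpNorm_of_ae_le_mul (ae_of_all _ fun x => ?_) 2
    rw [norm_smul, mul_comm]; rfl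
  have hmem : ∀ e, MemLp (fun x => ψ (x - p e) • c e) 2 (volume.restrict (Γ.interval e)) :=
    fun e => ⟨by
      have : Continuous fun x => ψ (x - p e) • c e := by fun_prop
      exact this.aestronglyMeasurable, (hle e).trans_lt
        (ENNReal.mul_lt_top ENNReal.ofReal_lt_top hψ2.2)⟩
  refine ⟨⟨fun e => (hmem e).toLp _, ?_⟩, fun e => (hmem e).coeFn_toLp⟩
  refine memℓp_gen ?_
  have hsum := (lp.memℓp c).summable (by norm_num)
  simp only [ENNReal.toReal_ofNat, Real.rpow_ofNat] at hsum ⊢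
  refine Summable.of_nonneg_of_le (fun _ => by positivity) (fun e => ?_)
    (hsum.mul_right ((eLpNorm ψ 2 volume).toReal ^ 2))
  rw [← mul_pow]
  refine pow_le_pow_left₀ (norm_nonneg _) ?_ 2
  rw [Lp.norm_toLp]
  refine (ENNReal.toReal_mono (ENNReal.mul_lt_top ENNReal.ofReal_lt_top hψ2.2).ne
    (hle e)).trans_eq ?_
  rw [ENNReal.toReal_mul, ENNReal.toReal_ofReal (norm_nonneg _)]

/-- The test function is supported in `I`, so both integrals extend to the whole line, where
classical integration by parts has no boundary terms. -/
lemma hasWeakDeriv_translate (I : Set ℝ) {ψ : ℝ → ℝ} (hψ : ContDiff ℝ ∞ ψ) (p : ℝ) (c : 𝕜) :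
    HasWeakDeriv I (fun x => ψ (x - p) • c) (fun x => deriv ψ (x - p) • c) := by
  intro φ hφ hφc hφI
  have hφ1 : ContDiff ℝ 1 φ := hφ.of_le (by exact_mod_cast le_top)
  have hψ1 : ContDiff ℝ 1 ψ := hψ.of_le (by exact_mod_cast le_top)
  have hφd : Continuous (deriv φ) := hφ1.continuous_deriv (by norm_num)
  have hψd : Continuous (deriv ψ) := hψ1.continuous_deriv (by norm_num)
  have hψs : Continuous fun x => ψ (x - p) := hψ.continuous.comp (by fun_prop)
  have hψds : Continuous fun x => deriv ψ (x - p) := hψd.comp (by fun_prop)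
  rw [setIntegral_eq_integral_of_forall_compl_eq_zero fun x hx => by
      rw [image_eq_zero_of_notMem_tsupport fun h => hx (hφI (tsupport_deriv_subset h)), zero_smul],
    setIntegral_eq_integral_of_forall_compl_eq_zero fun x hx => by
      rw [image_eq_zero_of_notMem_tsupport fun h => hx (hφI h), zero_smul]]
  simp_rw [smul_smul]
  rw [integral_smul_const, integral_smul_const, ← neg_smul]
  congr 1
  have := integral_mul_deriv_eq_deriv_mul_of_integrable (u := fun x => φ x) (u' := deriv φ)
    (v := fun x => ψ (x - p)) (v' := fun x => deriv ψ (x - p))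
    (fun x _ => ((hφ1.differentiable (by norm_num)) x).hasDerivAt)
    (fun x _ => ((hψ1.differentiable (by norm_num)) (x - p)).hasDerivAt.comp_sub_const x p)
    ((hφ.continuous.mul hψds).integrable_of_hasCompactSupport hφc.mul_right)
    ((hφd.mul hψs).integrable_of_hasCompactSupport hφc.deriv.mul_right)
    ((hφ.continuous.mul hψs).integrable_of_hasCompactSupport hφc.mul_right)
  rw [this, neg_neg]

/-- Elements of the domain of the maximal operator with prescribed smooth profile. -/
lemma exists_mem_domain_translate {ψ : ℝ → ℝ} (hψ : ContDiff ℝ ∞ ψ) (hc : HasCompactSupport ψ)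
    (p : E → ℝ) (c : lp (fun _ : E => 𝕜) 2) :
    ∃ f : (Γ.maxDeriv 𝕜).domain,
      (∀ e, (f : Γ.L2Space 𝕜) e =ᵐ[volume.restrict (Γ.interval e)] fun x => ψ (x - p e) • c e) ∧
      (∀ e, Γ.maxDeriv 𝕜 f e =ᵐ[volume.restrict (Γ.interval e)]
        fun x => deriv ψ (x - p e) • c e) ∧
      ∀ e, EqOn (contRep (Γ.interval e) ((f : Γ.L2Space 𝕜) e)) (fun x => ψ (x - p e) • c e)
        (closure (Γ.interval e)) := by
  have hψ1 : ContDiff ℝ 1 ψ := hψ.of_le (by exact_mod_cast le_top)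
  obtain ⟨f, hf⟩ := exists_coe_eq_translate (Γ := Γ) hψ.continuous hc p c
  obtain ⟨g, hg⟩ := exists_coe_eq_translate (Γ := Γ) (hψ1.continuous_deriv (by norm_num))
    hc.deriv p c
  have hfg : IsDeriv f g := fun e =>
    (hasWeakDeriv_translate _ hψ (p e) (c e)).congr_ae (hf e).symm (hg e).symm
  refine ⟨⟨f, g, hfg⟩, hf, fun e => ?_, fun e => ?_⟩
  · rw [(Γ.maxDeriv_spec 𝕜 ⟨f, g, hfg⟩).unique hfg]
    exact hg e
  · have hψs : Continuous fun x => ψ (x - p e) • c e :=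
      (hψ.continuous.comp (by fun_prop)).smul continuous_const
    exact contRep_eq (Γ.isOpen_interval e) hψs.continuousOn (hf e).symm

/-- Extension by zero of a square summable family. -/
lemma exists_lp_extend {S : Set E} (ξ : lp (fun _ : S => 𝕜) 2) :
    ∃ c : lp (fun _ : E => 𝕜) 2, (∀ e : S, c e = ξ e) ∧ ∀ e ∉ S, c e = 0 := by
  classical
  let u : E → 𝕜 := fun e => if h : e ∈ S then ξ ⟨e, h⟩ else 0
  have hu : ∀ e : S, u e = ξ e := fun e => dif_pos e.2
  have hu0 : ∀ e ∉ S, u e = 0 := fun e he => dif_neg he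
  have hmem : Memℓp u 2 := by
    have hsum := (lp.memℓp ξ).summable (by norm_num)
    refine memℓp_gen ?_
    simp only [ENNReal.toReal_ofNat, Real.rpow_ofNat] at hsum ⊢
    rw [← Subtype.val_injective.summable_iff (f := fun e => ‖u e‖ ^ 2) (g := fun e : S => (e : E))]
    · exact hsum.congr fun e => by rw [Function.comp_apply, hu]
    · intro e he
      rw [hu0 e fun h => he ⟨⟨e, h⟩, rfl⟩]
      simp
  exact ⟨⟨u, hmem⟩, hu, hu0⟩

lemma le_toReal_sub_toReal {l : ℝ} {e : E} (h : (l : EReal) ≤ Γ.b e - Γ.a e)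
    (ha : e ∈ Γ.leftEdges) (hb : e ∈ Γ.rightEdges) :
    l ≤ (Γ.b e).toReal - (Γ.a e).toReal := by
  have hab := Γ.a_lt_b e
  rw [← EReal.coe_toReal (LT.lt.ne hb) (ne_bot_of_gt hab),
    ← EReal.coe_toReal (ne_top_of_lt hab) (LT.lt.ne' ha), ← EReal.coe_sub] at h
  exact EReal.coe_le_coe_iff.1 h

/-- The traces are jointly surjective. -/
lemma exists_rightTrace_eq_and_leftTrace_eq (hΓ : 0 < ⨅ e, (Γ.b e - Γ.a e))
    (ξ : lp (fun _ : Γ.rightEdges => 𝕜) 2) (η : lp (fun _ : Γ.leftEdges => 𝕜) 2) :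
    ∃ f : (Γ.maxDeriv 𝕜).domain, Γ.rightTrace 𝕜 hΓ f = ξ ∧ Γ.leftTrace 𝕜 hΓ f = η := by
  obtain ⟨l, hl, hle⟩ := exists_length hΓ
  -- The outer radius `l / 2` is less than any edge length: a bump centred at one end point is `1`
  -- there and `0` at the other.
  let B : ContDiffBump (0 : ℝ) := ⟨l / 4, l / 2, by positivity, by linarith⟩
  have hB0 : B 0 = 1 := B.one_of_mem_closedBall (Metric.mem_closedBall_self B.rIn_pos.le)
  have hBl : ∀ x, l ≤ |x| → B x = 0 := fun x hx => by
    refine B.zero_of_le_dist ?_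
    rw [Real.dist_eq, sub_zero]
    exact (show l / 2 ≤ l by linarith).trans hx
  -- `EReal.toReal` sends infinite end points to `0`, so bumps belonging to them would sit at a
  -- meaningless place; extension by zero gives them coefficient `0`.
  obtain ⟨c, hc, hc0⟩ := exists_lp_extend ξ
  obtain ⟨d, hd, hd0⟩ := exists_lp_extend η
  obtain ⟨f, -, -, hf⟩ := exists_mem_domain_translate (Γ := Γ) B.contDiff B.hasCompactSupport
    (fun e => (Γ.b e).toReal) c
  obtain ⟨g, -, -, hg⟩ := exists_mem_domain_translate (Γ := Γ) B.contDiff B.hasCompactSupport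
    (fun e => (Γ.a e).toReal) d
  refine ⟨f + g, ?_, ?_⟩
  · rw [map_add]
    refine lp.ext (funext fun e => ?_)
    have hcl := mem_closure hl (exists_right hl hle e)
    refine (congrArg₂ (· + ·) (hf e hcl) (hg e hcl)).trans ?_
    simp only [sub_self, hB0, one_smul, hc]
    rw [add_eq_left]
    by_cases ha : (e : E) ∈ Γ.leftEdges
    · rw [hBl _ ((le_toReal_sub_toReal (hle e) ha e.2).trans (le_abs_self _)), zero_smul]
    · rw [hd0 _ ha, smul_zero]
  · rw [map_add]
    refine lp.ext (funext fun e => ?_)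
    have hcl := mem_closure hl (exists_left hl hle e)
    refine (congrArg₂ (· + ·) (hf e hcl) (hg e hcl)).trans ?_
    simp only [sub_self, hB0, one_smul, hd]
    rw [add_eq_right]
    by_cases hb : (e : E) ∈ Γ.rightEdges
    · rw [hBl _ ?_, zero_smul]
      rw [abs_sub_comm]
      exact (le_toReal_sub_toReal (hle e) e.2 hb).trans (le_abs_self _)
    · rw [hc0 _ hb, smul_zero]

/-- The negative adjoint of the restriction of the maximal operator to the functions with vanishing
traces is contained in the maximal operator. -/
lemma isDeriv_of_forall_inner (hΓ : 0 < ⨅ e, (Γ.b e - Γ.a e)) {y x : Γ.L2Space 𝕜}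
    (h : ∀ u : (Γ.maxDeriv 𝕜).domain, Γ.rightTrace 𝕜 hΓ u = 0 → Γ.leftTrace 𝕜 hΓ u = 0 →
      inner 𝕜 (Γ.maxDeriv 𝕜 u) y + inner 𝕜 (u : Γ.L2Space 𝕜) x = 0) :
    IsDeriv y x := by
  classical
  intro e φ hφ hφc hφI
  obtain ⟨l, hl, hle⟩ := exists_length hΓ
  -- With this choice the test element `u` is `φ` on the edge `e` and zero on every other edge.
  let c : lp (fun _ : E => 𝕜) 2 := lp.single 2 e (1 : 𝕜)
  have hce : c e = 1 := lp.single_apply_self _ _ _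
  have hcne : ∀ e', e' ≠ e → c e' = 0 := fun e' he' => lp.single_apply_ne _ _ _ he'
  obtain ⟨u, hu, hu', hur⟩ := exists_mem_domain_translate (Γ := Γ) hφ hφc (fun _ => 0) c
  -- The support of `φ` lies in the open edge, which omits its end points; hence both traces of `u`
  -- vanish.
  have hend : ∀ (e' : E) (z : ℝ), z ∉ Γ.interval e' → φ (z - 0) • c e' = 0 := fun e' z hz => by
    by_cases he' : e' = e
    · subst he'
      rw [sub_zero, image_eq_zero_of_notMem_tsupport fun h => hz (hφI h), zero_smul]
    · rw [hcne _ he', smul_zero]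
  have hright : Γ.rightTrace 𝕜 hΓ u = 0 := lp.ext (funext fun e' => by
    refine (hur e' (mem_closure hl (exists_right hl hle e'))).trans (hend _ _ fun hz => ?_)
    have h2 := hz.2
    rw [EReal.coe_toReal (LT.lt.ne e'.2) (ne_bot_of_gt (Γ.a_lt_b e'))] at h2
    exact lt_irrefl _ h2)
  have hleft : Γ.leftTrace 𝕜 hΓ u = 0 := lp.ext (funext fun e' => by
    refine (hur e' (mem_closure hl (exists_left hl hle e'))).trans (hend _ _ fun hz => ?_)
    have h1 := hz.1
    rw [EReal.coe_toReal (ne_top_of_lt (Γ.a_lt_b e')) (LT.lt.ne' e'.2)] at h1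
    exact lt_irrefl _ h1)
  -- Only the edge `e` contributes, and the profile is real, so conjugation disappears; the
  -- hypothesis on `u` becomes the defining identity of the weak derivative.
  have hinner : ∀ {v w : Γ.L2Space 𝕜} {ψ : ℝ → ℝ},
      (∀ e, v e =ᵐ[volume.restrict (Γ.interval e)] fun x => ψ (x - 0) • c e) →
      inner 𝕜 v w = ∫ x in Γ.interval e, ψ x • w e x := fun {v w ψ} hv => by
    rw [lp.inner_eq_tsum, tsum_eq_single e fun e' he' => ?_, L2.inner_def]
    · refine integral_congr_ae ((hv e).mono fun x hx => ?_)
      simp only [hx, hce, sub_zero, inner_smul_left_eq_smul]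
      rw [RCLike.inner_apply']
      simp
    · have : v e' = 0 := by
        refine Lp.ext (((hv e').trans (ae_of_all _ fun x => ?_)).trans (Lp.coeFn_zero _ _ _).symm)
        exact (congrArg _ (hcne e' he')).trans (smul_zero _)
      rw [this, inner_zero_left]
  have := h u hright hleft
  rw [hinner hu', hinner hu] at this
  exact eq_neg_of_add_eq_zero_left this

end MetricGraph

/-! ### Boundary triples and the main theorem -/

/-- Membership in the graph of a skew-self-adjoint operator. -/
lemma LinearPMap.isSkewSelfAdjoint_iff {𝕜 X : Type*} [RCLike 𝕜] [NormedAddCommGroup X]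
    [InnerProductSpace 𝕜 X] {H : X →ₗ.[𝕜] X} :
    H.IsSkewSelfAdjoint ↔ ∀ p : X × X, p ∈ H.graph ↔
      ∀ u : H.domain, inner 𝕜 (H u) p.1 + inner 𝕜 (u : X) p.2 = 0 := by
  have h : ∀ p : X × X,
      p ∈ H.graph.adjoint.map (LinearMap.prodMap LinearMap.id (-LinearMap.id)) ↔
        ∀ u : H.domain, inner 𝕜 (H u) p.1 + inner 𝕜 (u : X) p.2 = 0 := fun p => by
    rw [Submodule.mem_map]
    constructor
    · rintro ⟨q, hq, rfl⟩ u
      have := (Submodule.mem_adjoint_iff _ _).1 hq _ _ (H.mem_graph u)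
      simpa [sub_eq_add_neg] using this
    · intro hp
      -- The sign change in the second component is its own inverse and turns the difference in the
      -- adjoint condition into a sum.
      refine ⟨(p.1, -p.2), (Submodule.mem_adjoint_iff _ _).2 fun a b hab => ?_, by simp⟩
      obtain ⟨u, rfl, rfl⟩ := (H.mem_graph_iff).1 hab
      simpa using hp u
  rw [LinearPMap.IsSkewSelfAdjoint, Submodule.IsSkewSelfAdjoint, SetLike.ext_iff]
  simp_rw [h]

/-- Given a boundary triple for `A`, i.e. jointly surjective boundary maps `R` and `S` for which
Green's formula holds, the skew-self-adjoint restrictions of `A` correspond to unitary operators. -/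
theorem LinearPMap.isSkewSelfAdjoint_iff_exists_linearIsometryEquiv {𝕜 X Y Z : Type*} [RCLike 𝕜]
    [NormedAddCommGroup X] [InnerProductSpace 𝕜 X]
    [NormedAddCommGroup Y] [InnerProductSpace 𝕜 Y] [CompleteSpace Y]
    [NormedAddCommGroup Z] [InnerProductSpace 𝕜 Z] [CompleteSpace Z]
    {A : X →ₗ.[𝕜] X} {R : A.domain →ₗ[𝕜] Y} {S : A.domain →ₗ[𝕜] Z}
    (hgreenA : ∀ f g : A.domain,
      inner 𝕜 (A f) (g : X) + inner 𝕜 (f : X) (A g) = inner 𝕜 (R f) (R g) - inner 𝕜 (S f) (S g))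
    (hsurj : ∀ ξ η, ∃ f, R f = ξ ∧ S f = η)
    (hmin : ∀ y x, (∀ u : A.domain, R u = 0 → S u = 0 →
      inner 𝕜 (A u) y + inner 𝕜 (u : X) x = 0) → (y, x) ∈ A.graph)
    {H : X →ₗ.[𝕜] X} (hH : H ≤ A) :
    H.IsSkewSelfAdjoint ↔ ∃ L : Y ≃ₗᵢ[𝕜] Z,
      (H.domain : Set X) = {f | ∃ hf : f ∈ A.domain, L (R ⟨f, hf⟩) = S ⟨f, hf⟩} := by
  have hHu : ∀ u : H.domain, H u = A ⟨u, hH.1 u.2⟩ := fun u => hH.2 rfl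
  have hmem : ∀ f : A.domain, (f : X) ∈ H.domain →
      ((f : X), A f) ∈ H.graph := fun f hf =>
    (H.mem_graph_iff).2 ⟨⟨f, hf⟩, rfl, hHu ⟨f, hf⟩⟩
  have hgreen : ∀ (u : H.domain) (f : A.domain),
      inner 𝕜 (H u) (f : X) + inner 𝕜 (u : X) (A f) =
        inner 𝕜 (R ⟨u, hH.1 u.2⟩) (R f) -
          inner 𝕜 (S ⟨u, hH.1 u.2⟩) (S f) := fun u f => by
    rw [hHu]
    exact hgreenA ⟨u, hH.1 u.2⟩ f
  rw [LinearPMap.isSkewSelfAdjoint_iff]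
  constructor
  · intro hs
    -- Green's formula turns the graph condition for `(f, A f)` into one that depends on `f` only
    -- through its boundary values.
    have hdom : ∀ f : A.domain, (f : X) ∈ H.domain ↔ ∀ u : H.domain,
        inner 𝕜 (R ⟨u, hH.1 u.2⟩) (R f) =
          inner 𝕜 (S ⟨u, hH.1 u.2⟩) (S f) := fun f => by
      simp_rw [← sub_eq_zero (b := inner 𝕜 (S _) _), ← hgreen]
      rw [← hs ((f : X), A f)]
      exact ⟨hmem f, fun h => LinearPMap.mem_domain_of_mem_graph h⟩
    let M := (H.domain.comap A.domain.subtype).map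
      ((R).prod (S))
    -- An `f` sharing its boundary values with some `g` in the domain of `H` is itself in that
    -- domain, because the criterion `hdom` sees only those values.
    have hM : ∀ f : A.domain,
        (R f, S f) ∈ M ↔ (f : X) ∈ H.domain := by
      refine fun f => ⟨?_, fun hf => ⟨f, hf, rfl⟩⟩
      rintro ⟨g, hg, hgf⟩
      rw [hdom]
      obtain ⟨h1, h2⟩ := Prod.ext_iff.1 hgf
      simp only [LinearMap.prod_apply] at h1 h2
      rw [← h1, ← h2]
      exact (hdom g).1 hg
    obtain ⟨L, hL⟩ := exists_linearIsometryEquiv_of_forall_mem_iff M fun p => by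
      obtain ⟨f, hf1, hf2⟩ := hsurj p.1 p.2
      obtain rfl : (R f, S f) = p := Prod.ext hf1 hf2
      rw [hM, hdom]
      constructor
      · rintro h q ⟨g, hg, rfl⟩
        exact h ⟨g, hg⟩
      · exact fun h u => h _ ((hM ⟨u, hH.1 u.2⟩).2 u.2)
    refine ⟨L, Set.ext fun f => ⟨fun hf => ⟨hH.1 hf, ?_⟩, ?_⟩⟩
    · exact (hL (_, _)).1 ((hM ⟨f, hH.1 hf⟩).2 hf)
    · rintro ⟨hf, hLf⟩
      exact (hM ⟨f, hf⟩).1 ((hL (_, _)).2 hLf)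
  · rintro ⟨L, hL⟩
    have hdom : ∀ f : A.domain, (f : X) ∈ H.domain ↔
        L (R f) = S f := fun f => by
      rw [← SetLike.mem_coe, hL]
      exact ⟨fun ⟨_, h⟩ => h, fun h => ⟨f.2, h⟩⟩
    rintro ⟨y, x⟩
    constructor
    · intro hp u
      obtain ⟨f, rfl, rfl⟩ := (H.mem_graph_iff).1 hp
      have h := hgreen u ⟨f, hH.1 f.2⟩
      rw [← (hdom ⟨u, hH.1 u.2⟩).1 u.2, ← (hdom ⟨f, hH.1 f.2⟩).1 f.2, L.inner_map_map,
        sub_self] at h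
      rwa [hHu f]
    · intro hp
      -- Elements with vanishing boundary values satisfy `L 0 = 0`, so they lie in the domain of `H`
      -- and may be used as test elements.
      have hyx : (y, x) ∈ A.graph := hmin y x fun u h1 h2 => by
        have hu := (hdom u).2 (by rw [h1, h2, L.map_zero])
        have := hp ⟨u, hu⟩
        rwa [hHu] at this
      obtain ⟨f, rfl, rfl⟩ := (A.mem_graph_iff).1 hyx
      refine hmem f ?_
      refine (hdom f).2 ?_
      -- It remains to see `R f = L⁻¹ (S f)`. An element `g` with boundary values `(ξ, L ξ)` is in
      -- the domain of `H`, so Green's formula gives `⟪ξ, R f⟫ = ⟪L ξ, S f⟫` for every `ξ`.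
      rw [← LinearIsometryEquiv.eq_symm_apply]
      refine ext_inner_left 𝕜 fun ξ => ?_
      obtain ⟨g, hg1, hg2⟩ := hsurj ξ (L ξ)
      have hg := (hdom g).2 (by rw [hg1, hg2])
      have h := hgreen ⟨g, hg⟩ f
      rw [hp ⟨g, hg⟩] at h
      simp only [Subtype.coe_eta, hg1, hg2] at h
      rw [eq_comm, sub_eq_zero] at h
      rw [h, ← L.inner_map_map ξ, L.apply_symm_apply]

theorem mainTheorem2 {𝕜 : Type*} [RCLike 𝕜] {V E : Type*} (Γ : MetricGraph V E)
    (hΓ : 0 < ⨅ e, (Γ.b e - Γ.a e))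
    (H : Γ.L2Space 𝕜 →ₗ.[𝕜] Γ.L2Space 𝕜) (hH : H ≤ Γ.maxDeriv 𝕜) :
    H.IsSkewSelfAdjoint ↔
      ∃ L : lp (fun _ : Γ.rightEdges => 𝕜) 2 ≃ₗᵢ[𝕜] lp (fun _ : Γ.leftEdges => 𝕜) 2,
        (H.domain : Set (Γ.L2Space 𝕜)) =
          {f | ∃ hf : f ∈ (Γ.maxDeriv 𝕜).domain,
            L (Γ.rightTrace 𝕜 hΓ ⟨f, hf⟩) = Γ.leftTrace 𝕜 hΓ ⟨f, hf⟩} := by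
  refine LinearPMap.isSkewSelfAdjoint_iff_exists_linearIsometryEquiv (A := Γ.maxDeriv 𝕜)
    (R := Γ.rightTrace 𝕜 hΓ) (S := Γ.leftTrace 𝕜 hΓ) ?_ ?_ ?_ hH
  · exact MetricGraph.inner_maxDeriv_add_inner_maxDeriv hΓ
  · exact MetricGraph.exists_rightTrace_eq_and_leftTrace_eq hΓ
  · intro y x h
    have hyx := MetricGraph.isDeriv_of_forall_inner hΓ h
    exact (LinearPMap.mem_graph_iff _).2
      ⟨⟨y, x, hyx⟩, rfl, (Γ.maxDeriv_spec 𝕜 ⟨y, x, hyx⟩).unique hyx⟩
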